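/- A $d$-dimensional VASS is a pair $V=(Q,T)$ with a finite set $Q$ of states and a finite set $T\subseteq Q\times\mathbb Z^d\times Q$ of transitions; a configuration $q(\vec x)$ consists of a state $q\in Q$ and a vector $\vec x\in\mathbb N^d$. A run $c_0\xrightarrow{u_1}c_1\cdots\xrightarrow{u_m}c_m$ of length $m$ is a sequence of configurations $c_j=q_j(\vec x_j)$ such that $u_j=(q_{j-1},\vec x_j-\vec x_{j-1},q_j)\in T$ for $1\le j\le m$. It is an unboundedness witness for $c_0$ if there is an index $i<m$ with $c_i<c_m$, that is, $q_i=q_m$, $\vec x_i\le\vec x_m$ componentwise, and $\vec x_i\neq\vec x_m$. For a VASS $V$, let $n=|Q|$, let $M=\max\{\|\vec a\|_\infty : (p,\vec a,q)\in T\}$ (with $M=0$ if $T=\emptyset$ or $d=0$), and let $g$ be the geometric dimension of $V$, i.e. the dimension of the $\mathbb Q$-vector space spanned by the effects of all cycles of $V$, where a cycle is a sequence of consecutive transitions that starts and ends at the same state and its effect is the sum of the vectors of its transitions. (No nonnegativity of counters is required along cycles.) Let $f:\mathbb N\to\mathbb N$, $f(x)=(4x+2)^{2x+1}$. **Theorem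 5.1.** There is a polynomial $P$ in three variables with nonnegative integer coefficients such that for every $d\in\mathbb N$, every $d$-dimensional VASS $V$ and every configuration $s$ of $V$: if there is an unboundedness witness for $s$ in $V$, then there is an unboundedness witness for $s$ in $V$ of length at most $P(d,n,M)^{f(g)}$. -/

import Mathlib

/-- A transition `(p, a, q)` of a `d`-dimensional VASS with state set `Q`, with effect `a ∈ ℤ^d`. -/
structure Transition (Q : Type*) (d : ℕ) where
  src : Q
  eff : Fin d → ℤ
  tgt : Q

/-- A `d`-dimensional vector addition system with states with state set `Q`: it is given by its
finite set of transitions. (Finiteness of `Q` is asked for by an instance argument.) -/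
structure VASS (Q : Type*) (d : ℕ) where
  transitions : Finset (Transition Q d)

/-- A configuration `q(x)`: a state together with a nonnegative counter vector `x ∈ ℕ^d`. -/
structure Config (Q : Type*) (d : ℕ) where
  state : Q
  counters : Fin d → ℕ

namespace Config

variable {Q : Type*} {d : ℕ}

/-- `q(x) ≤ q'(x')` iff `q = q'` and `x ≤ x'` componentwise. -/
instance : LE (Config Q d) where
  le c c' := c.state = c'.state ∧ c.counters ≤ c'.counters

/-- `q(x) < q'(x')` iff `q = q'`, `x ≤ x'` componentwise and `x ≠ x'`. -/
instance : LT (Config Q d) where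
  lt c c' := c ≤ c' ∧ c.counters ≠ c'.counters

end Config

namespace VASS

variable {Q : Type*} {d : ℕ}

/-- `V.IsPath p π q`: the sequence of transitions `π` is a path of `V` from state `p` to `q`. -/
inductive IsPath (V : VASS Q d) : Q → List (Transition Q d) → Q → Prop
  | nil (p : Q) : IsPath V p [] p
  | cons {t : Transition Q d} {π : List (Transition Q d)} {q : Q} :
      t ∈ V.transitions → IsPath V t.tgt π q → IsPath V t.src (t :: π) q

/-- The effect of a sequence of transitions: the sum of the effects of its members. -/
def pathEff (π : List (Transition Q d)) : Fin d → ℤ :=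
  (π.map Transition.eff).sum

/-- The cycle space of `V`: the rational vector space spanned by the effects of all cycles, that
is, of all paths that start and end in the same state. -/
def cycleSpace (V : VASS Q d) : Submodule ℚ (Fin d → ℚ) :=
  Submodule.span ℚ {v | ∃ (q : Q) (θ : List (Transition Q d)),
    V.IsPath q θ q ∧ v = fun i => (pathEff θ i : ℚ)}

/-- The geometric dimension of `V`: the dimension of its cycle space. -/
noncomputable def geomDim (V : VASS Q d) : ℕ :=
  Module.finrank ℚ V.cycleSpace

/-- The greatest absolute value of an entry of the effect of a transition of `V`
(`0` if there is no such entry). -/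
def maxNorm (V : VASS Q d) : ℕ :=
  V.transitions.sup fun t => Finset.univ.sup fun i => (t.eff i).natAbs

/-- `V.Step c t c'`: the transition `t` of `V` induces a one-step run from `c` to `c'`. Both `c`
and `c'` have nonnegative counters, being configurations. -/
def Step (V : VASS Q d) (c : Config Q d) (t : Transition Q d) (c' : Config Q d) : Prop :=
  t ∈ V.transitions ∧ c.state = t.src ∧ c'.state = t.tgt ∧
    ∀ i, (c.counters i : ℤ) + t.eff i = (c'.counters i : ℤ)

/-- `V.IsRun c π c'`: the sequence of transitions `π` induces a run of `V` from `c` to `c'`. The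
length of the run is the number of transitions in `π`. -/
inductive IsRun (V : VASS Q d) : Config Q d → List (Transition Q d) → Config Q d → Prop
  | nil (c : Config Q d) : IsRun V c [] c
  | cons {c c' c'' : Config Q d} {t : Transition Q d} {π : List (Transition Q d)} :
      V.Step c t c' → IsRun V c' π c'' → IsRun V c (t :: π) c''

/-- The sequence `π = u₁ ⋯ uₘ` induces a run `c₀ → c₁ → ⋯ → cₘ` from `c₀ = s` that is an
unboundedness witness: `cᵢ < cₘ` for some `i < m`. Here `π₁ = u₁ ⋯ uᵢ` and `π₂ = uᵢ₊₁ ⋯ uₘ`. -/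
def IsUnboundednessWitness (V : VASS Q d) (s : Config Q d) (π : List (Transition Q d)) : Prop :=
  ∃ (π₁ π₂ : List (Transition Q d)) (c c' : Config Q d),
    π = π₁ ++ π₂ ∧ π₂ ≠ [] ∧ V.IsRun s π₁ c ∧ V.IsRun c π₂ c' ∧ c < c'

end VASS

/-! This is Rackoff's induction, carried out on a rank instead of the number of counters. Only the
counters in a set `J` are kept nonnegative, but the final loop must have nonnegative nonzero effect
on all counters (`HasWitness`). The rank of `J` is that of its coordinates as linear forms on the
cycle space, hence at most g.

Let L bound the witnesses of smaller rank, and call a counter small if it is less than (M+1)L.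
Suppose that the small counters of some node on a witness have smaller rank than `J`. From there on
the other counters can be forgotten: induction gives a witness of length at most L, too short to
exhaust them (`HasWitness.lift`). On any one walk, the nodes whose small counters have full rank are
few: two of them with the same state differ by the effect of a cycle, so the state and the values of
spanning small counters determine the node (`card_nodes_le`). Hence the walk to the first deficient
node can be made short.

If no node is deficient, the prefix shortens likewise and the loop visits at most N nodes. It splits
into a short walk through all of them and cycles of length at most N. The multiplicities of the
cycles solve a linear system, which up to scaling has a solution of size exponential in g rather
than d (`exists_small_scaled_solution`), whence `exists_short_loop`. The recursion has g+1 levels.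
-/

/-! ### Linear algebra: small solutions of linear inequalities -/

/-- Conic Carathéodory: a nonnegative combination of finitely many vectors can be rewritten as a
nonnegative combination with linearly independent support. -/
theorem exists_nonneg_linearIndepOn_support {κ E : Type*} [Fintype κ] [AddCommGroup E]
    [Module ℚ E] (v : κ → E) (x : κ → ℚ) (hx : ∀ i, 0 ≤ x i) :
    ∃ y : κ → ℚ, (∀ i, 0 ≤ y i) ∧ ∑ i, y i • v i = ∑ i, x i • v i ∧
      LinearIndepOn ℚ v {i | y i ≠ 0} := by
  classical
  induction hN : (Finset.univ.filter fun i => x i ≠ 0).card using Nat.strong_induction_on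
    generalizing x with
  | _ N ih =>
  by_cases hind : LinearIndepOn ℚ v {i | x i ≠ 0}
  · exact ⟨x, hx, rfl, hind⟩
  have hset : {i | x i ≠ 0} = ((Finset.univ.filter fun i => x i ≠ 0 : Finset κ) : Set κ) := by
    ext; simp
  rw [hset, linearIndepOn_finset_iff] at hind
  push Not at hind
  obtain ⟨f₀, hf₀, i₀, hi₀, hne₀⟩ := hind
  obtain ⟨f, hf, i₁, hi₁, hpos⟩ : ∃ f : κ → ℚ,
      ∑ i ∈ Finset.univ.filter (fun i => x i ≠ 0), f i • v i = 0 ∧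
      ∃ i ∈ Finset.univ.filter (fun i => x i ≠ 0), 0 < f i := by
    rcases lt_or_gt_of_ne hne₀ with h | h
    · exact ⟨fun i => - f₀ i, by simp [hf₀], i₀, hi₀, by simpa using h⟩
    · exact ⟨f₀, hf₀, i₀, hi₀, h⟩
  -- With the least ratio as factor, subtracting the relation `f` keeps all coefficients nonnegative
  -- and kills the `k`-th.
  obtain ⟨k, hk, hmin⟩ := Finset.exists_min_image
    (Finset.univ.filter fun i => x i ≠ 0 ∧ 0 < f i) (fun i => x i / f i)
    ⟨i₁, by simpa using ⟨by simpa using hi₁, hpos⟩⟩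
  simp only [Finset.mem_filter, Finset.mem_univ, true_and] at hk hmin
  set t := x k / f k with ht
  have ht0 : 0 ≤ t := div_nonneg (hx k) hk.2.le
  set y : κ → ℚ := fun i => if x i ≠ 0 then x i - t * f i else 0 with hy
  have hy0 : ∀ i, 0 ≤ y i := by
    intro i
    simp only [hy]
    split_ifs with h
    · rcases le_or_gt (f i) 0 with h' | h'
      · nlinarith [hx i, mul_nonneg ht0 (neg_nonneg.2 h')]
      · have := hmin i ⟨h, h'⟩
        rw [le_div_iff₀ h'] at this
        linarith
    · exact le_rfl
  have hsum : ∑ i, y i • v i = ∑ i, x i • v i := by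
    have h1 : ∀ i, y i • v i = x i • v i - t • (if x i ≠ 0 then f i • v i else 0) := by
      intro i
      simp only [hy]
      split_ifs with h
      · rw [sub_smul, mul_smul]
      · simp only [ne_eq, not_not] at h
        simp [h]
    simp_rw [h1]
    rw [Finset.sum_sub_distrib, ← Finset.smul_sum, ← Finset.sum_filter, hf, smul_zero, sub_zero]
  have hlt : (Finset.univ.filter fun i => y i ≠ 0).card < N := by
    rw [← hN]
    apply Finset.card_lt_card
    rw [Finset.ssubset_iff_of_subset]
    · refine ⟨k, by simpa using hk.1, ?_⟩
      have : t * f k = x k := div_mul_cancel₀ _ hk.2.ne'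
      simp [hy, this]
    · intro i
      simp only [hy, Finset.mem_filter, Finset.mem_univ, true_and]
      intro h h'
      simp [h'] at h
  obtain ⟨z, hz0, hz, hzi⟩ := ih _ hlt y hy0 rfl
  exact ⟨z, hz0, hz.trans hsum, hzi⟩

/-- A matrix with linearly independent columns has a nonsingular maximal square submatrix. -/
theorem Matrix.exists_submatrix_det_ne_zero {m n : Type*} [Finite m] [Fintype n] [DecidableEq n]
    (A : Matrix m n ℚ) (hA : LinearIndependent ℚ A.transpose.row) :
    ∃ f : n → m, (A.submatrix f id).det ≠ 0 := by
  have := Fintype.ofFinite m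
  -- Row rank equals column rank, so a basis of the row space chosen among the rows has exactly
  -- `card n` members.
  have hr : Module.finrank ℚ (Submodule.span ℚ (Set.range A.row)) = Fintype.card n := by
    rw [← Matrix.rank_eq_finrank_span_row, ← Matrix.rank_transpose]
    exact hA.rank_matrix
  obtain ⟨r, hr1, -, hr3⟩ := Submodule.exists_fun_fin_finrank_span_eq ℚ (Set.range A.row)
  choose g hg using hr1
  let e : n ≃ Fin (Module.finrank ℚ (Submodule.span ℚ (Set.range A.row))) :=
    Fintype.equivOfCardEq (by simp [hr])
  refine ⟨g ∘ e, ?_⟩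
  have hrow : (A.submatrix (g ∘ e) id).row = r ∘ e := by
    funext i
    rw [Function.comp_apply, ← hg]
    rfl
  have : IsUnit (A.submatrix (g ∘ e) id) := by
    rw [← Matrix.linearIndependent_rows_iff_isUnit, hrow]
    exact hr3.comp _ e.injective
  exact ((Matrix.isUnit_iff_isUnit_det _).1 this).ne_zero

theorem Fintype.sum_eq_sum_subtype {ι M : Type*} [Fintype ι] [AddCommMonoid M] {p : ι → Prop}
    [DecidablePred p] (F : ι → M) (h : ∀ i, ¬ p i → F i = 0) :
    ∑ i, F i = ∑ i : {i // p i}, F i.1 := by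
  rw [← Finset.sum_subtype (Finset.univ.filter p) (by simp) F]
  exact (Finset.sum_filter_of_ne fun i _ hi => by_contra fun hp => hi (h i hp)).symm

/-- Up to scaling, a solvable system `∑ λᵢ aᵢ ≥ b`, `λ ≥ 0`, has a small solution whose size
depends on the dimension of the span of the `aᵢ` only. -/
theorem exists_small_scaled_solution {ι : Type*} [Fintype ι] {d h R : ℕ} (hR : 1 ≤ R)
    (a : ι → Fin d → ℤ) (b : Fin d → ℤ) (ha : ∀ i j, |a i j| ≤ R) (hb : ∀ j, |b j| ≤ R)
    (U : Submodule ℚ (Fin d → ℚ)) (hU : Module.finrank ℚ U ≤ h)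
    (haU : ∀ i, (fun j => (a i j : ℚ)) ∈ U)
    (l : ι → ℕ) (hl : ∀ j, b j ≤ ∑ i, (l i : ℤ) * a i j) :
    ∃ (D : ℕ) (μ : ι → ℕ), 1 ≤ D ∧ (∀ j, D * b j ≤ ∑ i, (μ i : ℤ) * a i j) ∧
      D ≤ h.factorial * R ^ h ∧ ∑ i, μ i ≤ h * (h.factorial * R ^ h) := by
  classical
  -- The vectors `-Pi.single j 1` are slacks that turn the inequalities into equations.
  let v : ι ⊕ Fin d → Fin d → ℚ := Sum.elim (fun i j => (a i j : ℚ)) (fun j => -Pi.single j 1)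
  let x : ι ⊕ Fin d → ℚ := Sum.elim (fun i => (l i : ℚ))
    (fun j => ((∑ i, (l i : ℤ) * a i j - b j : ℤ) : ℚ))
  have hsum : ∀ (y : ι ⊕ Fin d → ℚ) (j : Fin d), (∑ i, y i • v i) j =
      ∑ i, y (Sum.inl i) * a i j - y (Sum.inr j) := by
    intro y j
    simp [v, Fintype.sum_sum_type, Finset.sum_apply, Pi.single_apply, sub_eq_add_neg]
  obtain ⟨y, hy0, hy, hyi⟩ := exists_nonneg_linearIndepOn_support v x (by
    rintro (i | j)
    · simp [x]
    · simp only [x, Sum.elim_inr]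
      exact_mod_cast sub_nonneg.2 (hl j))
  have hyb : ∀ j, ∑ i, y (Sum.inl i) * a i j - y (Sum.inr j) = b j := by
    intro j
    rw [← hsum, hy, hsum]
    simp [x]
  let S := {i : ι // y (Sum.inl i) ≠ 0}
  let Z := {j : Fin d // y (Sum.inr j) = 0}
  -- Where the slack vanishes, `y` satisfies equations in the unknowns from `S` alone.
  let A : Matrix Z S ℤ := Matrix.of fun j i => a i.1 j.1
  have hcol : LinearIndependent ℚ ((A.map (Int.cast : ℤ → ℚ)).transpose.row) := by
    rw [Fintype.linearIndependent_iff]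
    intro c hc
    have hc' : ∀ j : Fin d, y (Sum.inr j) = 0 → ∑ i : S, c i * a i.1 j = 0 := by
      intro j hj
      have := congrFun hc ⟨j, hj⟩
      simpa [A, Finset.sum_apply] using this
    -- A relation between the columns of `A` extends to one between the support vectors: the slacks
    -- absorb the rows outside `Z`.
    let z : ι ⊕ Fin d → ℚ := Sum.elim (fun i => if hi : y (Sum.inl i) ≠ 0 then c ⟨i, hi⟩ else 0)
      (fun j => ∑ i : S, c i * a i.1 j)
    have hzl : ∀ j, ∑ i, z (Sum.inl i) * a i j = ∑ i : S, c i * a i.1 j := by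
      intro j
      rw [Fintype.sum_eq_sum_subtype (p := fun i => y (Sum.inl i) ≠ 0)
        (fun i => z (Sum.inl i) * (a i j : ℚ)) (fun i hi => by simp [z, hi])]
      exact Finset.sum_congr rfl fun i _ => by simp only [z, Sum.elim_inl, dif_pos i.2]
    have hzz : ∑ i, z i • v i = 0 := by
      funext j
      rw [hsum, hzl]
      simp [z]
    have hset : {i | y i ≠ 0} = ((Finset.univ.filter fun i => y i ≠ 0 : Finset _) : Set _) := by
      ext; simp
    rw [hset, linearIndepOn_finset_iff] at hyi
    intro i
    have hzf : ∑ i ∈ Finset.univ.filter (fun i => y i ≠ 0), z i • v i = 0 := by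
      rw [← hzz]
      apply Finset.sum_filter_of_ne
      rintro (i | j) - hne hy0'
      · simp [z, hy0'] at hne
      · simp only [z, Sum.elim_inr, hc' j hy0', zero_smul, ne_eq, not_true_eq_false] at hne
    have := hyi z hzf (Sum.inl i.1) (by simpa using i.2)
    simpa only [z, Sum.elim_inl, dif_pos i.2] using this
  obtain ⟨f, hf⟩ := Matrix.exists_submatrix_det_ne_zero _ hcol
  let B : Matrix S S ℤ := A.submatrix f id
  have hdet : B.det ≠ 0 := by
    intro h0
    apply hf
    have : (A.map (Int.cast : ℤ → ℚ)).submatrix f id = B.map (Int.cast : ℤ → ℚ) := rfl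
    rw [this, ← Int.cast_det, h0, Int.cast_zero]
  let bb : S → ℤ := fun i => b (f i).1
  have hcard : Fintype.card S ≤ h := by
    refine le_trans ?_ hU
    -- The vectors used lie in `U` and are independent, so their number is bounded independently of
    -- `d`.
    have h1 : LinearIndependent ℚ (fun i : S => (⟨_, haU i.1⟩ : U)) := by
      apply LinearIndependent.of_comp U.subtype
      have := hyi.comp (fun i : S => (⟨Sum.inl i.1, i.2⟩ : {i | y i ≠ 0}))
        (fun i j hij => Subtype.ext (Sum.inl_injective (congrArg Subtype.val hij)))
      exact this
    exact h1.fintype_card_le_finrank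
  have hbound : ∀ C : Matrix S S ℤ, (∀ i j, |C i j| ≤ (R : ℤ)) →
      C.det.natAbs ≤ h.factorial * R ^ h := by
    intro C hC
    have := Matrix.det_le (abv := AbsoluteValue.abs) (A := C) (x := (R : ℤ)) hC
    simp only [AbsoluteValue.abs_apply, nsmul_eq_mul] at this
    have h2 : C.det.natAbs ≤ (Fintype.card S).factorial * R ^ Fintype.card S := by
      zify; exact this
    exact h2.trans (Nat.mul_le_mul (Nat.factorial_le hcard) (Nat.pow_le_pow_right hR hcard))
  have hcr : ∀ i : S, (B.det : ℚ) * y (Sum.inl i.1) = (B.cramer bb i : ℤ) := by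
    let Bq : Matrix S S ℚ := B.map (Int.cast : ℤ → ℚ)
    have hmul : Bq.mulVec (fun i => y (Sum.inl i.1)) = fun i => (bb i : ℚ) := by
      funext i
      have h1 := hyb (f i).1
      rw [(f i).2, sub_zero, Fintype.sum_eq_sum_subtype (p := fun i => y (Sum.inl i) ≠ 0) _
        (fun i hi => by simpa using Or.inl (by simpa using hi))] at h1
      rw [← h1]
      exact Finset.sum_congr rfl fun i _ => mul_comm _ _
    intro i
    have h1 : Bq.cramer (fun i => (bb i : ℚ)) = Bq.det • fun i : S => y (Sum.inl i.1) := by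
      rw [Matrix.cramer_eq_adjugate_mulVec, ← hmul, Matrix.mulVec_mulVec, Matrix.adjugate_mul,
        Matrix.smul_mulVec, Matrix.one_mulVec]
    have h2 := congrFun h1 i
    rw [Matrix.cramer_apply, Pi.smul_apply, smul_eq_mul] at h2
    rw [Matrix.cramer_apply, Int.cast_det, Int.cast_det, ← h2]
    congr 1
    ext i' j'
    simp only [Matrix.map_apply, Matrix.updateCol_apply]
    split_ifs <;> rfl
  let μ : ι → ℕ := fun i => if hi : y (Sum.inl i) ≠ 0 then (B.cramer bb ⟨i, hi⟩).natAbs else 0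
  have hμ : ∀ i, (μ i : ℚ) = (B.det.natAbs : ℚ) * y (Sum.inl i) := by
    intro i
    by_cases hi : y (Sum.inl i) ≠ 0
    · simp only [μ, hi, dif_pos, ne_eq, not_false_eq_true]
      rw [Nat.cast_natAbs, Nat.cast_natAbs, Int.cast_abs, Int.cast_abs, ← hcr ⟨i, hi⟩, abs_mul,
        abs_of_nonneg (hy0 _)]
    · have h0 : y (Sum.inl i) = 0 := by simpa using hi
      simp [μ, h0]
  -- By Cramer's rule, `|det B|` clears all denominators of the solution.
  refine ⟨B.det.natAbs, μ, Nat.one_le_iff_ne_zero.2 (by simpa using hdet), ?_, ?_, ?_⟩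
  · intro j
    have h1 : (B.det.natAbs : ℚ) * b j ≤ ∑ i, (μ i : ℚ) * a i j := by
      simp_rw [hμ, mul_assoc]
      rw [← Finset.mul_sum]
      apply mul_le_mul_of_nonneg_left _ (Nat.cast_nonneg _)
      linarith [hyb j, hy0 (Sum.inr j)]
    generalize B.det.natAbs = D at h1
    exact_mod_cast h1
  · exact hbound B fun i j => ha _ _
  · have h1 : ∀ i : S, μ i.1 ≤ h.factorial * R ^ h := by
      intro i
      simp only [μ, i.2, dif_pos, ne_eq, not_false_eq_true, Matrix.cramer_apply]
      apply hbound
      intro i' j'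
      rw [Matrix.updateCol_apply]
      split_ifs
      · exact hb _
      · exact ha _ _
    have h2 : ∑ i, μ i = ∑ i : S, μ i.1 :=
      Fintype.sum_eq_sum_subtype _ fun i hi => by simp only [μ, dif_neg hi]
    rw [h2]
    calc ∑ i : S, μ i.1 ≤ ∑ i : S, h.factorial * R ^ h := Finset.sum_le_sum fun i _ => h1 i
      _ = Fintype.card S * (h.factorial * R ^ h) := by simp
      _ ≤ _ := Nat.mul_le_mul_right _ hcard

/-! ### Walks in labelled graphs and their decomposition into cycles -/

section Walks

variable {S T A : Type*} (E : S → T → S → Prop)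

/-- `IsWalk E a w b`: the list `w` of labels and successive nodes is a walk from `a` to `b` in the
labelled graph with edge relation `E`. -/
def IsWalk : S → List (T × S) → S → Prop
  | a, [], b => a = b
  | a, e :: w, b => E a e.1 e.2 ∧ IsWalk e.2 w b

/-- The nodes visited by a walk that starts in `a`. -/
def walkNodes (a : S) (w : List (T × S)) : List S := a :: w.map Prod.snd

/-- The total weight of a walk. -/
def walkWeight [AddCommMonoid A] (wt : T → A) (w : List (T × S)) : A :=
  (w.map fun e => wt e.1).sum

variable {E}

theorem walkNodes_cons (a : S) (e : T × S) (w : List (T × S)) :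
    walkNodes a (e :: w) = a :: walkNodes e.2 w := rfl

theorem start_mem_walkNodes (a : S) (w : List (T × S)) : a ∈ walkNodes a w :=
  List.mem_cons_self

theorem length_walkNodes (a : S) (w : List (T × S)) : (walkNodes a w).length = w.length + 1 := by
  simp [walkNodes]

section Weight

variable [AddCommMonoid A] (wt : T → A)

theorem walkWeight_nil : walkWeight wt ([] : List (T × S)) = 0 := rfl

theorem walkWeight_cons (e : T × S) (w : List (T × S)) :
    walkWeight wt (e :: w) = wt e.1 + walkWeight wt w := by simp [walkWeight]

theorem walkWeight_append (u w : List (T × S)) :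
    walkWeight wt (u ++ w) = walkWeight wt u + walkWeight wt w := by simp [walkWeight]

end Weight

theorem IsWalk.append {a b c : S} {u w : List (T × S)} (hu : IsWalk E a u b)
    (hw : IsWalk E b w c) : IsWalk E a (u ++ w) c := by
  induction u generalizing a with
  | nil => cases hu; exact hw
  | cons e u ih => exact ⟨hu.1, ih hu.2⟩

theorem IsWalk.end_mem {a b : S} {w : List (T × S)} (hw : IsWalk E a w b) :
    b ∈ walkNodes a w := by
  induction w generalizing a with
  | nil => cases hw; exact start_mem_walkNodes _ _
  | cons e w ih => exact List.mem_cons_of_mem _ (ih hw.2)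

theorem IsWalk.mem_walkNodes_append {a b x : S} {u w : List (T × S)} (hu : IsWalk E a u b) :
    x ∈ walkNodes a (u ++ w) ↔ x ∈ walkNodes a u ∨ x ∈ walkNodes b w := by
  induction u generalizing a with
  | nil =>
    cases hu
    simp only [List.nil_append, walkNodes, List.map_nil, List.mem_cons, List.not_mem_nil, or_false]
    tauto
  | cons e u ih =>
    simp only [List.cons_append, walkNodes_cons, List.mem_cons, ih hu.2]
    tauto

/-- A walk can be split at any node it visits. -/
theorem IsWalk.exists_split {a b x : S} {w : List (T × S)} (hw : IsWalk E a w b)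
    (hx : x ∈ walkNodes a w) :
    ∃ u v, w = u ++ v ∧ IsWalk E a u x ∧ IsWalk E x v b := by
  induction w generalizing a with
  | nil =>
    obtain rfl : x = a := by simpa [walkNodes] using hx
    exact ⟨[], [], rfl, rfl, hw⟩
  | cons e w ih =>
    rw [walkNodes_cons, List.mem_cons] at hx
    rcases hx with rfl | hx
    · exact ⟨[], e :: w, rfl, rfl, hw⟩
    · obtain ⟨u, v, rfl, hu, hv⟩ := ih hw.2 hx
      exact ⟨e :: u, v, rfl, ⟨hw.1, hu⟩, hv⟩

/-- A walk that visits a node with property `p` can be split at the first such node. -/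
theorem IsWalk.exists_split_first {a b : S} {w : List (T × S)} (hw : IsWalk E a w b)
    (p : S → Prop) (hp : ∃ x ∈ walkNodes a w, p x) :
    ∃ u v x, w = u ++ v ∧ IsWalk E a u x ∧ IsWalk E x v b ∧ p x ∧
      ∀ y ∈ walkNodes a u, y = x ∨ ¬ p y := by
  induction w generalizing a with
  | nil =>
    obtain ⟨x, hx, hpx⟩ := hp
    obtain rfl : x = a := by simpa [walkNodes] using hx
    exact ⟨[], [], x, rfl, rfl, hw, hpx, by simp [walkNodes]⟩
  | cons e w ih =>
    by_cases ha : p a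
    · exact ⟨[], e :: w, a, rfl, rfl, hw, ha, by simp [walkNodes]⟩
    obtain ⟨x, hx, hpx⟩ := hp
    rw [walkNodes_cons, List.mem_cons] at hx
    rcases hx with rfl | hx
    · exact absurd hpx ha
    obtain ⟨u, v, y, rfl, hu, hv, hy, hall⟩ := ih hw.2 ⟨x, hx, hpx⟩
    refine ⟨e :: u, v, y, rfl, ⟨hw.1, hu⟩, hv, hy, ?_⟩
    intro z hz
    rw [walkNodes_cons, List.mem_cons] at hz
    rcases hz with rfl | hz
    · exact Or.inr ha
    · exact hall z hz

/-- Of two nodes visited by a walk, one is reachable from the other by a walk. -/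
theorem IsWalk.connected {a b x y : S} {w : List (T × S)} (hw : IsWalk E a w b)
    (hx : x ∈ walkNodes a w) (hy : y ∈ walkNodes a w) :
    (∃ u, IsWalk E x u y) ∨ ∃ u, IsWalk E y u x := by
  obtain ⟨u, v, rfl, hu, hv⟩ := hw.exists_split hx
  rcases hu.mem_walkNodes_append.1 hy with h | h
  · obtain ⟨-, u', -, -, hu'⟩ := hu.exists_split h
    exact Or.inr ⟨u', hu'⟩
  · obtain ⟨v', -, -, hv', -⟩ := hv.exists_split h
    exact Or.inl ⟨v', hv'⟩

section Decomposition

variable [AddCommMonoid A] (wt : T → A)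

/-- `cs` is a list of closed walks of length at most `N` with base points in `l`. -/
def AreShortCycles (E : S → T → S → Prop) (N : ℕ) (l : List S) (cs : List (S × List (T × S))) :
    Prop :=
  ∀ c ∈ cs, IsWalk E c.1 c.2 c.1 ∧ c.1 ∈ l ∧ c.2.length ≤ N

theorem AreShortCycles.append {N : ℕ} {l : List S} {cs cs' : List (S × List (T × S))}
    (h : AreShortCycles E N l cs) (h' : AreShortCycles E N l cs') :
    AreShortCycles E N l (cs ++ cs') := fun c hc =>
  (List.mem_append.1 hc).elim (h c) (h' c)

theorem AreShortCycles.mono {N : ℕ} {l l' : List S} {cs : List (S × List (T × S))}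
    (h : AreShortCycles E N l cs) (hl : l ⊆ l') : AreShortCycles E N l' cs := fun c hc =>
  ⟨(h c hc).1, hl (h c hc).2.1, (h c hc).2.2⟩

/-- A walk decomposes into a simple walk with the same ends and short cycles. -/
theorem IsWalk.exists_simple [DecidableEq S] {a b : S} {w : List (T × S)} (hw : IsWalk E a w b)
    (F : Finset S) (hF : ∀ x ∈ walkNodes a w, x ∈ F) :
    ∃ u cs, IsWalk E a u b ∧ (walkNodes a u).Nodup ∧ walkNodes a u ⊆ walkNodes a w ∧
      AreShortCycles E F.card (walkNodes a w) cs ∧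
      walkWeight wt w = walkWeight wt u + (cs.map fun c => walkWeight wt c.2).sum := by
  induction w generalizing a with
  | nil => exact ⟨[], [], hw, by simp [walkNodes], by simp, by simp [AreShortCycles], by simp⟩
  | cons e w ih =>
    rw [walkNodes_cons] at hF ⊢
    obtain ⟨u, cs, hu, hnd, hsub, hcs, hsum⟩ :=
      ih hw.2 fun x hx => hF x (List.mem_cons_of_mem _ hx)
    have hcs' := hcs.mono (List.subset_cons_self a (walkNodes e.2 w))
    by_cases ha : a ∈ walkNodes e.2 u
    -- The new edge and the part of `u` up to `a` form a cycle, which is split off.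
    · obtain ⟨u₁, u₂, rfl, h₁, h₂⟩ := hu.exists_split ha
      have hN : walkNodes e.2 (u₁ ++ u₂) = walkNodes e.2 u₁ ++ u₂.map Prod.snd := by
        simp [walkNodes]
      have hN' : (walkNodes a u₂).Sublist (walkNodes e.2 (u₁ ++ u₂)) := by
        rcases List.eq_nil_or_concat u₁ with rfl | ⟨u₀, e', rfl⟩
        · cases h₁; exact List.Sublist.refl _
        · have : e'.2 = a := by
            clear * - h₁
            generalize e.2 = s at h₁
            induction u₀ generalizing s with
            | nil => exact h₁.2
            | cons f u₀ ih => exact ih _ h₁.2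
          subst this
          simp only [walkNodes, List.concat_eq_append, List.map_append, List.map_cons,
            List.append_assoc, List.singleton_append]
          exact (List.sublist_append_right _ _).cons _
      refine ⟨u₂, (a, e :: u₁) :: cs, h₂, hnd.sublist hN', ?_, ?_, ?_⟩
      · exact fun x hx => List.mem_cons_of_mem _ (hsub (hN'.subset hx))
      · intro c hc
        rcases List.mem_cons.1 hc with rfl | hc
        · refine ⟨⟨hw.1, h₁⟩, List.mem_cons_self, ?_⟩
          have hnd₁ : (walkNodes e.2 u₁).Nodup := by
            rw [hN] at hnd
            exact hnd.of_append_left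
          rw [List.length_cons, ← length_walkNodes e.2, ← List.toFinset_card_of_nodup hnd₁]
          apply Finset.card_le_card
          intro x hx
          apply hF
          refine List.mem_cons_of_mem _ (hsub ?_)
          rw [hN]
          exact List.mem_append_left _ (List.mem_toFinset.1 hx)
        · exact hcs' c hc
      · simp only [walkWeight_cons, walkWeight_append, List.map_cons, List.sum_cons, hsum]
        abel
    · refine ⟨e :: u, cs, ⟨hw.1, hu⟩, ?_, ?_, hcs', ?_⟩
      · rw [walkNodes_cons]
        exact List.nodup_cons.2 ⟨ha, hnd⟩
      · rw [walkNodes_cons]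
        exact List.cons_subset_cons _ hsub
      · rw [walkWeight_cons, walkWeight_cons, hsum, add_assoc]

theorem IsWalk.exists_simple_length_lt {a b : S} {w : List (T × S)} (hw : IsWalk E a w b)
    (F : Finset S) (hF : ∀ x ∈ walkNodes a w, x ∈ F) :
    ∃ u, IsWalk E a u b ∧ walkNodes a u ⊆ walkNodes a w ∧ u.length < F.card := by
  classical
  obtain ⟨u, -, hu, hnd, hsub, -⟩ := hw.exists_simple (fun _ => (0 : ℕ)) F hF
  refine ⟨u, hu, hsub, ?_⟩
  rw [Nat.lt_iff_add_one_le, ← length_walkNodes a, ← List.toFinset_card_of_nodup hnd]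
  exact Finset.card_le_card fun x hx => hF x (hsub (List.mem_toFinset.1 hx))

/-- A walk decomposes into a walk of quadratic length with the same ends, which still visits a
given set of nodes, and short cycles. -/
theorem IsWalk.exists_visiting {a b : S} {w : List (T × S)} (hw : IsWalk E a w b)
    (F : Finset S) (hF : ∀ x ∈ walkNodes a w, x ∈ F) (X : Finset S)
    (hX : ∀ x ∈ X, x ∈ walkNodes a w) :
    ∃ u cs, IsWalk E a u b ∧ u.length ≤ F.card * (X.card + 1) ∧
      (∀ x ∈ X, x ∈ walkNodes a u) ∧
      AreShortCycles E F.card (walkNodes a w) cs ∧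
      walkWeight wt w = walkWeight wt u + (cs.map fun c => walkWeight wt c.2).sum := by
  classical
  induction hn : X.card using Nat.strong_induction_on generalizing a b w X with
  | _ n ih =>
  rcases X.eq_empty_or_nonempty with rfl | ⟨x, hx⟩
  · obtain ⟨u, cs, hu, hnd, hsub, hcs, hsum⟩ := hw.exists_simple wt F hF
    refine ⟨u, cs, hu, ?_, by simp, hcs, hsum⟩
    have : u.length + 1 ≤ F.card := by
      rw [← length_walkNodes a, ← List.toFinset_card_of_nodup hnd]
      exact Finset.card_le_card fun x hx => hF x (hsub (List.mem_toFinset.1 hx))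
    calc u.length ≤ F.card * 1 := by omega
      _ ≤ _ := Nat.mul_le_mul_left _ (by omega)
  · obtain ⟨w₁, w₂, rfl, h₁, h₂⟩ := hw.exists_split (hX x hx)
    have hmem := fun y => h₁.mem_walkNodes_append (x := y) (w := w₂)
    -- Each remaining node is assigned to one half only, so at most `X.card + 1` simple pieces
    -- arise.
    let X₁ := (X.erase x).filter fun y => y ∈ walkNodes a w₁
    let X₂ := (X.erase x).filter fun y => ¬ y ∈ walkNodes a w₁
    have hcard : X₁.card + X₂.card + 1 = n := by
      rw [Finset.card_filter_add_card_filter_not, ← hn]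
      exact Finset.card_erase_add_one hx
    obtain ⟨u₁, cs₁, hu₁, hl₁, hv₁, hcs₁, hs₁⟩ := ih X₁.card (by omega) h₁
      (fun y hy => hF y ((hmem y).2 (Or.inl hy))) X₁
      (fun y hy => (Finset.mem_filter.1 hy).2) rfl
    obtain ⟨u₂, cs₂, hu₂, hl₂, hv₂, hcs₂, hs₂⟩ := ih X₂.card (by omega) h₂
      (fun y hy => hF y ((hmem y).2 (Or.inr hy))) X₂
      (fun y hy => by
        obtain ⟨hy, hy'⟩ := Finset.mem_filter.1 hy
        exact ((hmem y).1 (hX y (Finset.mem_of_mem_erase hy))).resolve_left hy') rfl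
    refine ⟨u₁ ++ u₂, cs₁ ++ cs₂, hu₁.append hu₂, ?_, ?_,
      (hcs₁.mono fun y hy => (hmem y).2 (Or.inl hy)).append
        (hcs₂.mono fun y hy => (hmem y).2 (Or.inr hy)), ?_⟩
    · rw [List.length_append, ← hcard]
      calc _ ≤ F.card * (X₁.card + 1) + F.card * (X₂.card + 1) := Nat.add_le_add hl₁ hl₂
        _ = _ := by ring
    · intro y hy
      rw [hu₁.mem_walkNodes_append]
      by_cases hyx : y = x
      · exact Or.inl (hyx ▸ hu₁.end_mem)
      · by_cases hy₁ : y ∈ walkNodes a w₁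
        · exact Or.inl (hv₁ y (by simp [X₁, *]))
        · exact Or.inr (hv₂ y (by simp [X₂, *]))
    · rw [walkWeight_append, walkWeight_append, hs₁, hs₂, List.map_append, List.sum_append]
      abel

/-- Closed walks can be inserted into a walk that visits their base points. -/
theorem IsWalk.exists_insert {a b : S} {w : List (T × S)} (hw : IsWalk E a w b) {N : ℕ}
    (cs : List (S × List (T × S))) (hcs : AreShortCycles E N (walkNodes a w) cs) :
    ∃ u, IsWalk E a u b ∧ u.length ≤ w.length + cs.length * N ∧
      walkWeight wt u = walkWeight wt w + (cs.map fun c => walkWeight wt c.2).sum := by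
  induction cs generalizing w with
  | nil => exact ⟨w, hw, by simp, by simp⟩
  | cons c cs ih =>
    obtain ⟨hc, hc1, hc2⟩ := hcs c List.mem_cons_self
    obtain ⟨u, v, rfl, hu, hv⟩ := hw.exists_split hc1
    obtain ⟨u', hu', hl', hw'⟩ := ih ((hu.append hc).append hv) (fun c' hc' => by
      obtain ⟨h1, h2, h3⟩ := hcs c' (List.mem_cons_of_mem _ hc')
      refine ⟨h1, ?_, h3⟩
      rw [(hu.append hc).mem_walkNodes_append, hu.mem_walkNodes_append]
      rcases hu.mem_walkNodes_append.1 h2 with h | h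
      · exact Or.inl (Or.inl h)
      · exact Or.inr h)
    refine ⟨u', hu', ?_, ?_⟩
    · simp only [List.length_append, List.length_cons] at hl' ⊢
      calc _ ≤ _ := hl'
        _ ≤ _ := by rw [Nat.add_mul]; omega
    · rw [hw']
      simp only [walkWeight_append, List.map_cons, List.sum_cons]
      abel

end Decomposition

end Walks

theorem List.sum_map_eq_sum_get {α A : Type*} [AddCommMonoid A] (cs : List α) (f : α → A) :
    (cs.map f).sum = ∑ i : Fin cs.length, f (cs.get i) := by
  rw [← List.sum_ofFn, ← Function.comp_def f, ← List.map_ofFn, List.ofFn_get]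

/-- Repetition of the entries of a list with given multiplicities. -/
theorem List.exists_repeat {α A : Type*} [AddCommMonoid A] (cs : List α) (μ : Fin cs.length → ℕ)
    (f : α → A) :
    ∃ cs' : List α, (∀ c ∈ cs', c ∈ cs) ∧ cs'.length = ∑ i, μ i ∧
      (cs'.map f).sum = ∑ i, μ i • f (cs.get i) := by
  refine ⟨(List.ofFn fun i => List.replicate (μ i) (cs.get i)).flatten, ?_, ?_, ?_⟩
  · intro c hc
    rw [List.mem_flatten] at hc
    obtain ⟨l, hl, hc⟩ := hc
    rw [List.mem_ofFn] at hl
    obtain ⟨i, rfl⟩ := hl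
    rw [List.eq_of_mem_replicate hc]
    exact List.get_mem _ _
  · rw [List.length_flatten, List.map_ofFn, List.sum_ofFn]
    simp
  · rw [List.map_flatten, List.sum_flatten, List.map_ofFn, List.map_ofFn, List.sum_ofFn]
    simp

/-! ### Runs that record only some of the counters -/

namespace VASS

variable {Q : Type*} {d : ℕ} (V : VASS Q d)

/-- The step relation of `V` when only the counters in `J` are recorded (and required to be
nonnegative). -/
def PartialStep (J : Finset (Fin d)) (c : Q × (J → ℕ)) (t : Transition Q d)
    (c' : Q × (J → ℕ)) : Prop :=
  t ∈ V.transitions ∧ c.1 = t.src ∧ c'.1 = t.tgt ∧ ∀ j : J, (c.2 j : ℤ) + t.eff j = c'.2 j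

/-- The effect of a walk on all counters. -/
abbrev walkEff {S : Type*} (w : List (Transition Q d × S)) : Fin d → ℤ :=
  walkWeight Transition.eff w

theorem abs_eff_le {t : Transition Q d} (ht : t ∈ V.transitions) (i : Fin d) :
    |t.eff i| ≤ V.maxNorm := by
  rw [← Int.natCast_natAbs, Nat.cast_le]
  exact (Finset.le_sup (f := fun i => (t.eff i).natAbs) (Finset.mem_univ i)).trans
    (Finset.le_sup (f := fun t : Transition Q d => Finset.univ.sup fun i => (t.eff i).natAbs) ht)

variable {V}

theorem isWalk_partialStep_counters {J : Finset (Fin d)} {a b : Q × (J → ℕ)}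
    {w : List (Transition Q d × (Q × (J → ℕ)))} (hw : IsWalk (V.PartialStep J) a w b) (j : J) :
    (a.2 j : ℤ) + walkEff w j = b.2 j := by
  induction w generalizing a with
  | nil => cases hw; simp [walkEff, walkWeight_nil]
  | cons e w ih =>
    rw [walkEff, walkWeight_cons, Pi.add_apply, ← add_assoc, hw.1.2.2.2 j]
    exact ih hw.2

theorem isWalk_partialStep_eff_le {J : Finset (Fin d)} {a b : Q × (J → ℕ)}
    {w : List (Transition Q d × (Q × (J → ℕ)))} (hw : IsWalk (V.PartialStep J) a w b)
    (i : Fin d) : |walkEff w i| ≤ (V.maxNorm * w.length : ℕ) := by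
  induction w generalizing a with
  | nil => simp [walkEff, walkWeight_nil]
  | cons e w ih =>
    rw [walkEff, walkWeight_cons, Pi.add_apply]
    refine (abs_add_le _ _).trans ?_
    have h1 := V.abs_eff_le hw.1.1 i
    have h2 := ih hw.2
    push_cast [List.length_cons] at h2 ⊢
    rw [walkEff] at h2
    linarith

theorem isWalk_partialStep_isPath {J : Finset (Fin d)} {a b : Q × (J → ℕ)}
    {w : List (Transition Q d × (Q × (J → ℕ)))} (hw : IsWalk (V.PartialStep J) a w b) :
    V.IsPath a.1 (w.map Prod.fst) b.1 := by
  induction w generalizing a with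
  | nil => cases hw; exact IsPath.nil _
  | cons e w ih =>
    obtain ⟨⟨h1, h2, h3, -⟩, h⟩ := hw
    rw [h2]
    refine IsPath.cons h1 ?_
    rw [← h3]
    exact ih h

theorem isWalk_partialStep_mem_cycleSpace {J : Finset (Fin d)} {a b : Q × (J → ℕ)}
    {w : List (Transition Q d × (Q × (J → ℕ)))} (hw : IsWalk (V.PartialStep J) a w b)
    (hab : a.1 = b.1) : (fun i => (walkEff w i : ℚ)) ∈ V.cycleSpace := by
  apply Submodule.subset_span
  refine ⟨a.1, w.map Prod.fst, ?_, ?_⟩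
  · have := isWalk_partialStep_isPath hw
    rwa [← hab] at this
  · simp [walkEff, walkWeight, pathEff, Function.comp_def]

/-- Forgetting the counters outside `J'`. -/
def restrictNode {J J' : Finset (Fin d)} (h : J' ⊆ J) (c : Q × (J → ℕ)) : Q × (J' → ℕ) :=
  (c.1, fun j => c.2 ⟨j.1, h j.2⟩)

theorem isWalk_partialStep_restrict {J J' : Finset (Fin d)} (h : J' ⊆ J) {a b : Q × (J → ℕ)}
    {w : List (Transition Q d × (Q × (J → ℕ)))} (hw : IsWalk (V.PartialStep J) a w b) :
    ∃ u, IsWalk (V.PartialStep J') (restrictNode h a) u (restrictNode h b) ∧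
      walkEff u = walkEff w := by
  induction w generalizing a with
  | nil => cases hw; exact ⟨[], rfl, rfl⟩
  | cons e w ih =>
    obtain ⟨u, hu, he⟩ := ih hw.2
    refine ⟨(e.1, restrictNode h e.2) :: u, ⟨⟨hw.1.1, hw.1.2.1, hw.1.2.2.1, ?_⟩, hu⟩, ?_⟩
    · exact fun j => hw.1.2.2.2 ⟨j.1, h j.2⟩
    · simp only [walkEff, walkWeight_cons] at he ⊢
      rw [he]

/-- A walk on the counters `J'` lifts to `J ⊇ J'` if the additional counters are large. -/
theorem isWalk_partialStep_lift {J J' : Finset (Fin d)} (h : J' ⊆ J) {a : Q × (J → ℕ)}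
    {b' : Q × (J' → ℕ)} {w : List (Transition Q d × (Q × (J' → ℕ)))}
    (hw : IsWalk (V.PartialStep J') (restrictNode h a) w b')
    (ha : ∀ j : J, j.1 ∉ J' → V.maxNorm * w.length ≤ a.2 j) :
    ∃ u b, IsWalk (V.PartialStep J) a u b ∧ restrictNode h b = b' ∧ walkEff u = walkEff w ∧
      u.length = w.length := by
  induction w generalizing a with
  | nil => exact ⟨[], a, rfl, hw, rfl, rfl⟩
  | cons e w ih =>
    obtain ⟨⟨h1, h2, h3, h4⟩, hw⟩ := hw
    have hnn : ∀ j : J, 0 ≤ (a.2 j : ℤ) + e.1.eff j ∧ (j.1 ∉ J' →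
        ((V.maxNorm * w.length : ℕ) : ℤ) ≤ (a.2 j : ℤ) + e.1.eff j) := by
      intro j
      have key : j.1 ∉ J' →
        ((V.maxNorm * w.length : ℕ) : ℤ) ≤ (a.2 j : ℤ) + e.1.eff j := by
        intro hj
        have h5 := abs_le.1 (V.abs_eff_le h1 j)
        have h6 := ha j hj
        rw [List.length_cons, mul_add, mul_one] at h6
        zify at h6 ⊢
        linarith
      refine ⟨?_, key⟩
      by_cases hj : j.1 ∈ J'
      · have := h4 ⟨j.1, hj⟩
        simp only [restrictNode] at this
        rw [this]
        exact Nat.cast_nonneg _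
      · exact (Nat.cast_nonneg _).trans (key hj)
    let c : Q × (J → ℕ) := (e.2.1, fun j => ((a.2 j : ℤ) + e.1.eff j).toNat)
    have hc : restrictNode h c = e.2 := by
      refine Prod.ext rfl (funext fun j => ?_)
      have := h4 j
      simp only [restrictNode, c] at this ⊢
      rw [this, Int.toNat_natCast]
    rw [← hc] at hw
    obtain ⟨u, b, hu, hb, he, hl⟩ := ih hw (fun j hj => by
      have := (hnn j).2 hj
      simp only [c]
      omega)
    refine ⟨(e.1, c) :: u, b, ⟨⟨h1, h2, h3, fun j => ?_⟩, hu⟩, hb, ?_, by simp [hl]⟩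
    · exact (Int.toNat_of_nonneg (hnn j).1).symm
    · simp only [walkEff, walkWeight_cons] at he ⊢
      rw [he]

/-- Walks are monotone in the initial counters. -/
theorem isWalk_partialStep_shift {J : Finset (Fin d)} {a b a' : Q × (J → ℕ)}
    {w : List (Transition Q d × (Q × (J → ℕ)))} (hw : IsWalk (V.PartialStep J) a w b)
    (hs : a'.1 = a.1) (hc : a.2 ≤ a'.2) :
    ∃ u b', IsWalk (V.PartialStep J) a' u b' ∧ b'.1 = b.1 ∧ walkEff u = walkEff w ∧
      u.length = w.length := by
  induction w generalizing a a' with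
  | nil => cases hw; exact ⟨[], a', rfl, hs, rfl, rfl⟩
  | cons e w ih =>
    obtain ⟨⟨h1, h2, h3, h4⟩, hw⟩ := hw
    -- The surplus `a'.2 - a.2` is carried along unchanged; the subtraction is not truncated, by
    -- `hc`.
    obtain ⟨u, b', hu, hb, he, hl⟩ := ih (a' := (e.2.1, fun j => e.2.2 j + (a'.2 j - a.2 j))) hw rfl
      (fun j => Nat.le_add_right _ _)
    refine ⟨(e.1, (e.2.1, fun j => e.2.2 j + (a'.2 j - a.2 j))) :: u, b',
      ⟨⟨h1, hs.trans h2, h3, fun j => ?_⟩, hu⟩, hb, ?_, by simp [hl]⟩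
    · have h5 := h4 j
      have h6 : a.2 j ≤ a'.2 j := hc j
      simp only
      omega
    · simp only [walkEff, walkWeight_cons] at he ⊢
      rw [he]

/-- A walk that does not decrease the counters in `J` can be iterated. -/
theorem isWalk_partialStep_iterate {J : Finset (Fin d)} {c c' a : Q × (J → ℕ)}
    {w : List (Transition Q d × (Q × (J → ℕ)))} (hw : IsWalk (V.PartialStep J) c w c')
    (hcc : c.1 = c'.1) (hle : c.2 ≤ c'.2) (hs : a.1 = c.1) (hc : c.2 ≤ a.2) (n : ℕ) :
    ∃ u b, IsWalk (V.PartialStep J) a u b ∧ b.1 = c.1 ∧ walkEff u = n • walkEff w ∧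
      u.length = n * w.length := by
  induction n generalizing a with
  | zero => exact ⟨[], a, rfl, hs, by simp [walkEff, walkWeight_nil], by simp⟩
  | succ n ih =>
    obtain ⟨u, b, hu, hb, he, hl⟩ := isWalk_partialStep_shift hw hs hc
    obtain ⟨u', b', hu', hb', he', hl'⟩ := ih (a := b) (hb.trans hcc.symm) (fun j => by
      have h1 := isWalk_partialStep_counters hu j
      have h2 := isWalk_partialStep_counters hw j
      have h3 : c.2 j ≤ c'.2 j := hle j
      have h4 : c.2 j ≤ a.2 j := hc j
      rw [he] at h1
      show c.2 j ≤ b.2 j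
      omega)
    refine ⟨u ++ u', b', hu.append hu', hb', ?_, ?_⟩
    · simp only [walkEff, walkWeight_append] at he he' ⊢
      rw [he, he', succ_nsmul, add_comm]
    · rw [List.length_append, hl, hl']
      ring

/-! ### Rank of sets of counters and the number of nodes -/

variable (V)

/-- The `j`-th coordinate as a linear form on the cycle space. -/
def coord (j : Fin d) : Module.Dual ℚ V.cycleSpace :=
  (LinearMap.proj j).comp V.cycleSpace.subtype

/-- The rank of the coordinates in `J` on the cycle space. -/
noncomputable def coordRank (J : Finset (Fin d)) : ℕ :=
  Module.finrank ℚ (Submodule.span ℚ (V.coord '' J))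

theorem coordRank_le_geomDim (J : Finset (Fin d)) : V.coordRank J ≤ V.geomDim := by
  rw [geomDim, ← Subspace.dual_finrank_eq]
  exact Submodule.finrank_le _

theorem geomDim_le : V.geomDim ≤ d := by
  rw [geomDim]
  simpa using Submodule.finrank_le V.cycleSpace

/-- The counters of a node that are less than `B`. -/
noncomputable def smallCounters {J : Finset (Fin d)} (B : ℕ) (c : Q × (J → ℕ)) :
    Finset (Fin d) :=
  (Finset.univ.filter fun j : J => c.2 j < B).map (Function.Embedding.subtype _)

theorem mem_smallCounters {J : Finset (Fin d)} {B : ℕ} {c : Q × (J → ℕ)} {j : Fin d} :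
    j ∈ smallCounters B c ↔ ∃ h : j ∈ J, c.2 ⟨j, h⟩ < B := by
  simp [smallCounters]

theorem smallCounters_subset {J : Finset (Fin d)} (B : ℕ) (c : Q × (J → ℕ)) :
    smallCounters B c ⊆ J := fun _ hj => (mem_smallCounters.1 hj).1

/-- A basis of the span can be chosen among the small coordinates, since their span has full
dimension. -/
theorem exists_spanning_smallCounters {J : Finset (Fin d)} {B : ℕ} {c : Q × (J → ℕ)}
    (hc : V.coordRank J ≤ V.coordRank (smallCounters B c)) :
    ∃ f : Fin (V.coordRank J) → J, (∀ i, c.2 (f i) < B) ∧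
      Submodule.span ℚ (V.coord '' J) ≤ Submodule.span ℚ (Set.range fun i => V.coord (f i)) := by
  have hle : Submodule.span ℚ (V.coord '' smallCounters B c) ≤ Submodule.span ℚ (V.coord '' J) :=
    Submodule.span_mono (Set.image_mono (by exact_mod_cast smallCounters_subset B c))
  have heq := Submodule.eq_of_le_of_finrank_le hle hc
  obtain ⟨f, hf1, hf2, -⟩ :=
    Submodule.exists_fun_fin_finrank_span_eq ℚ (V.coord '' smallCounters B c)
  choose g hg hgf using hf1
  have hr : V.coordRank J = Module.finrank ℚ (Submodule.span ℚ (V.coord '' smallCounters B c)) := by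
    rw [heq, coordRank]
  let e := finCongr hr
  refine ⟨fun i => ⟨g (e i), smallCounters_subset B c (hg _)⟩, ?_, ?_⟩
  · intro i
    exact (mem_smallCounters.1 (hg (e i))).2
  · refine heq.ge.trans (hf2.ge.trans ?_)
    apply Submodule.span_mono
    rintro _ ⟨i, rfl⟩
    exact ⟨e.symm i, by simp [hgf]⟩

variable {V}

/-- Connected nodes with the same state are equal as soon as they agree on a spanning set of
counters. -/
theorem eq_of_eq_on_spanning {J : Finset (Fin d)} {x y : Q × (J → ℕ)}
    {w : List (Transition Q d × (Q × (J → ℕ)))} (hw : IsWalk (V.PartialStep J) x w y)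
    (hs : x.1 = y.1) {r : ℕ} (f : Fin r → J) (hf : ∀ i, x.2 (f i) = y.2 (f i))
    (hspan : Submodule.span ℚ (V.coord '' J) ≤
      Submodule.span ℚ (Set.range fun i => V.coord (f i))) : x = y := by
  let e : V.cycleSpace := ⟨_, isWalk_partialStep_mem_cycleSpace hw hs⟩
  have h1 : Submodule.span ℚ (Set.range fun i => V.coord (f i)) ≤
      LinearMap.ker (Module.Dual.eval ℚ V.cycleSpace e) := by
    rw [Submodule.span_le]
    rintro _ ⟨i, rfl⟩
    have h2 := isWalk_partialStep_counters hw (f i)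
    rw [hf i] at h2
    have h3 : walkEff w (f i) = 0 := by linarith
    show (walkEff w (f i) : ℚ) = 0
    rw [h3, Int.cast_zero]
  refine Prod.ext hs (funext fun j => ?_)
  have h2 : (walkEff w j : ℚ) = 0 := h1 (hspan (Submodule.subset_span ⟨j.1, j.2, rfl⟩))
  have h3 := isWalk_partialStep_counters hw j
  rw [Int.cast_eq_zero.1 h2] at h3
  omega

/-- Few nodes of a walk have small counters of full rank. -/
theorem card_nodes_le [Fintype Q] {J : Finset (Fin d)} {a b : Q × (J → ℕ)}
    {w : List (Transition Q d × (Q × (J → ℕ)))} (hw : IsWalk (V.PartialStep J) a w b) (B : ℕ)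
    (F : Finset (Q × (J → ℕ))) (hF : ∀ x ∈ F, x ∈ walkNodes a w)
    (hB : ∀ x ∈ F, V.coordRank J ≤ V.coordRank (smallCounters B x)) :
    F.card ≤ Fintype.card Q * (d * B) ^ V.coordRank J := by
  have hcode := fun x : F => V.exists_spanning_smallCounters (hB x.1 x.2)
  choose f hfB hf using hcode
  -- A node is encoded by its state together with the names and values of its spanning small
  -- counters.
  let code : F → Q × (Fin (V.coordRank J) → Fin d × Fin B) := fun x =>
    (x.1.1, fun i => ((f x i).1, ⟨x.1.2 (f x i), hfB x i⟩))
  have hinj : Function.Injective code := by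
    intro x y hxy
    have hs : x.1.1 = y.1.1 := congrArg (fun p => p.1) hxy
    have hi : ∀ i, f x i = f y i ∧ x.1.2 (f x i) = y.1.2 (f y i) := by
      intro i
      have h1 := congrFun (congrArg (fun p => p.2) hxy) i
      exact ⟨Subtype.ext (congrArg Prod.fst h1), congrArg (fun p => (Prod.snd p).1) h1⟩
    have hfx : ∀ i, x.1.2 (f x i) = y.1.2 (f x i) := fun i => by
      rw [(hi i).2, (hi i).1]
    apply Subtype.ext
    rcases hw.connected (hF x.1 x.2) (hF y.1 y.2) with ⟨u, hu⟩ | ⟨u, hu⟩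
    · exact eq_of_eq_on_spanning hu hs (f x) hfx (hf x)
    · exact (eq_of_eq_on_spanning hu hs.symm (f x) (fun i => (hfx i).symm) (hf x)).symm
  have := Fintype.card_le_of_injective code hinj
  simpa using this

end VASS

/-! ### Witnesses relative to a set of counters, and short loops -/

namespace VASS

variable {Q : Type*} {d : ℕ} (V : VASS Q d)

/-- There is a walk of length at most `L` from `a` that ends with a loop on the states whose effect
on *all* counters is nonnegative and nonzero. -/
def HasWitness (J : Finset (Fin d)) (a : Q × (J → ℕ)) (L : ℕ) : Prop :=
  ∃ w₁ w₂ c c', IsWalk (V.PartialStep J) a w₁ c ∧ IsWalk (V.PartialStep J) c w₂ c' ∧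
    c.1 = c'.1 ∧ 0 ≤ walkEff w₂ ∧ walkEff w₂ ≠ 0 ∧ w₁.length + w₂.length ≤ L

variable {V}

theorem HasWitness.mono {J : Finset (Fin d)} {a : Q × (J → ℕ)} {L L' : ℕ}
    (h : V.HasWitness J a L) (hL : L ≤ L') : V.HasWitness J a L' := by
  obtain ⟨w₁, w₂, c, c', h1, h2, h3, h4, h5, h6⟩ := h
  exact ⟨w₁, w₂, c, c', h1, h2, h3, h4, h5, h6.trans hL⟩

theorem HasWitness.restrict {J J' : Finset (Fin d)} (hJ : J' ⊆ J) {a : Q × (J → ℕ)} {L : ℕ}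
    (h : V.HasWitness J a L) : ∃ L', V.HasWitness J' (restrictNode hJ a) L' := by
  obtain ⟨w₁, w₂, c, c', h1, h2, h3, h4, h5, -⟩ := h
  obtain ⟨u₁, hu₁, -⟩ := isWalk_partialStep_restrict hJ h1
  obtain ⟨u₂, hu₂, he⟩ := isWalk_partialStep_restrict hJ h2
  exact ⟨_, u₁, u₂, _, _, hu₁, hu₂, h3, he ▸ h4, he ▸ h5, le_rfl⟩

theorem HasWitness.lift {J J' : Finset (Fin d)} (hJ : J' ⊆ J) {a : Q × (J → ℕ)} {L : ℕ}
    (h : V.HasWitness J' (restrictNode hJ a) L)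
    (ha : ∀ j : J, j.1 ∉ J' → V.maxNorm * L ≤ a.2 j) : V.HasWitness J a L := by
  obtain ⟨w₁, w₂, c, c', h1, h2, h3, h4, h5, h6⟩ := h
  obtain ⟨u, b, hu, -, he, hl⟩ := isWalk_partialStep_lift hJ (h1.append h2) (fun j hj =>
    (Nat.mul_le_mul_left _ (by rwa [List.length_append])).trans (ha j hj))
  obtain ⟨u₁, c₁, hu₁, hc₁, he₁, hl₁⟩ := isWalk_partialStep_lift hJ h1 (fun j hj =>
    (Nat.mul_le_mul_left _ (by omega)).trans (ha j hj))
  rw [← hc₁] at h2 h3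
  -- The first part consumes at most `maxNorm * w₁.length`, which leaves enough for `w₂`.
  obtain ⟨u₂, c₂, hu₂, hc₂, he₂, hl₂⟩ := isWalk_partialStep_lift hJ h2 (fun j hj => by
    have h7 := isWalk_partialStep_counters hu₁ j
    have h8 := (abs_le.1 (isWalk_partialStep_eff_le hu₁ j)).1
    have h9 := ha j hj
    have h10 := Nat.mul_le_mul_left V.maxNorm h6
    rw [mul_add] at h10
    rw [hl₁] at h8
    omega)
  refine ⟨u₁, u₂, c₁, c₂, hu₁, hu₂, ?_, he₂ ▸ h4, he₂ ▸ h5, by omega⟩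
  rw [← hc₂] at h3
  exact h3

/-- A loop with nonnegative nonzero effect that visits few nodes can be replaced by a short one. -/
theorem exists_short_loop {J : Finset (Fin d)} {c c' : Q × (J → ℕ)}
    {w : List (Transition Q d × (Q × (J → ℕ)))} (hw : IsWalk (V.PartialStep J) c w c')
    (hcc : c.1 = c'.1) (h0 : 0 ≤ walkEff w) (hne : walkEff w ≠ 0) (F : Finset (Q × (J → ℕ)))
    (hF : ∀ x, x ∈ F ↔ x ∈ walkNodes c w) {N : ℕ} (hN : F.card ≤ N) :
    ∃ u c'', IsWalk (V.PartialStep J) c u c'' ∧ c.1 = c''.1 ∧ 0 ≤ walkEff u ∧ walkEff u ≠ 0 ∧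
      u.length ≤ V.geomDim.factorial * (N * (N + 1) * (V.maxNorm + 1)) ^ V.geomDim *
        (N * (N + 1) * (V.geomDim + 1)) := by
  -- The skeleton `w₀` meets every node of `w`, so any cycle can be reinserted any number of times.
  obtain ⟨w₀, cs, hw₀, hl₀, hv₀, hcs, hs⟩ :=
    hw.exists_visiting Transition.eff F (fun x hx => (hF x).2 hx) F (fun x hx => (hF x).1 hx)
  have hN1 : 1 ≤ F.card := Finset.card_pos.2 ⟨c, (hF c).2 (start_mem_walkNodes _ _)⟩
  have hl₀' : w₀.length ≤ N * (N + 1) := hl₀.trans (Nat.mul_le_mul hN (by omega))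
  obtain ⟨i₀, hi₀⟩ : ∃ i, 1 ≤ walkEff w i := by
    by_contra! h
    exact hne (funext fun i => le_antisymm (Int.lt_add_one_iff.1 (h i)) (h0 i))
  set M := V.maxNorm
  set R := N * (N + 1) * (M + 1) with hR
  have hRN : 1 ≤ N * (N + 1) := Nat.mul_pos (by omega) (by omega)
  -- The cycles must make up for `w₀` and gain at least 1 on the counter `i₀`, on which `w` is
  -- positive.
  let b : Fin d → ℤ := fun j => (if j = i₀ then 1 else 0) - walkEff w₀ j
  have hsum := fun j => congrFun hs j
  simp only [Pi.add_apply] at hsum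
  rw [List.sum_map_eq_sum_get] at hsum
  obtain ⟨D, μ, hD, hμ, hDb, hμb⟩ := exists_small_scaled_solution (h := V.geomDim) (R := R)
    (Nat.mul_pos hRN (by omega)) (fun i => walkEff (cs.get i).2) b
    (fun i j => by
      obtain ⟨h1, -, h3⟩ := hcs _ (List.get_mem cs i)
      refine (isWalk_partialStep_eff_le h1 j).trans ?_
      rw [Nat.cast_le, hR]
      calc M * (cs.get i).2.length ≤ M * N := Nat.mul_le_mul_left _ (h3.trans hN)
        _ ≤ _ := by nlinarith [Nat.zero_le (M * N * N)])
    (fun j => by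
      have h1 := isWalk_partialStep_eff_le hw₀ j
      have h2 : M * w₀.length ≤ M * (N * (N + 1)) := Nat.mul_le_mul_left _ hl₀'
      have h3 : |b j| ≤ 1 + |walkEff w₀ j| := by
        refine (abs_sub _ _).trans ?_
        split_ifs <;> simp
      have h4 : 1 + M * (N * (N + 1)) ≤ R := by rw [hR]; nlinarith
      zify at h2 h4
      push_cast at h1 ⊢
      linarith)
    V.cycleSpace le_rfl
    (fun i => isWalk_partialStep_mem_cycleSpace (hcs _ (List.get_mem cs i)).1 rfl)
    -- The original loop uses each listed cycle once.
    (fun _ => 1)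
    (fun j => by
      have h1 := hsum j
      simp only [Finset.sum_apply] at h1
      simp only [b, Nat.cast_one, one_mul]
      have h2 : (if j = i₀ then 1 else 0) ≤ walkEff w j := by
        split_ifs with h
        · rw [h]; exact hi₀
        · exact h0 j
      simp only [walkEff] at h2 ⊢
      linarith)
  obtain ⟨cs', hcs', hlen', hsum'⟩ := cs.exists_repeat μ fun c => walkEff c.2
  obtain ⟨u₁, hu₁, hl₁, he₁⟩ := hw₀.exists_insert Transition.eff (N := N) cs' (fun c hc => by
    obtain ⟨h1, h2, h3⟩ := hcs c (hcs' c hc)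
    exact ⟨h1, hv₀ _ ((hF _).2 h2), h3.trans hN⟩)
  have hle : c.2 ≤ c'.2 := fun j => by
    have h1 := isWalk_partialStep_counters hw j
    have h2 : 0 ≤ walkEff w j := h0 j
    show c.2 j ≤ c'.2 j
    omega
  -- The solution is scaled by `D`, so `w₀` is needed `D` times. The first copy carries all cycles;
  -- the others can follow since `w₀` does not decrease the counters in `J`.
  obtain ⟨u₂, c'', hu₂, hs₂, he₂, hl₂⟩ :=
    isWalk_partialStep_iterate hw₀ hcc hle hcc.symm hle (D - 1)
  have heff : ∀ j, (D : ℤ) * (if j = i₀ then 1 else 0) ≤ walkEff (u₁ ++ u₂) j := by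
    intro j
    have h1 := hμ j
    have h2 : walkEff (u₁ ++ u₂) j = D * walkEff w₀ j + ∑ i, (μ i : ℤ) * walkEff (cs.get i).2 j := by
      obtain ⟨D, rfl⟩ : ∃ D', D = D' + 1 := ⟨D - 1, by omega⟩
      simp only [walkEff] at he₁ he₂ hsum' ⊢
      rw [walkWeight_append, he₁, he₂, hsum']
      simp only [Pi.add_apply, Pi.smul_apply, Finset.sum_apply, Nat.add_sub_cancel]
      simp only [nsmul_eq_mul]
      push_cast
      ring
    rw [h2]
    simp only [b, mul_sub] at h1
    linarith
  refine ⟨u₁ ++ u₂, c'', hu₁.append hu₂, hs₂.symm, ?_, ?_, ?_⟩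
  · intro j
    refine le_trans ?_ (heff j)
    split_ifs <;> simp
  · intro h
    have := heff i₀
    rw [h] at this
    simp at this
    omega
  · rw [List.length_append, hl₂]
    have h1 : u₁.length ≤ w₀.length + (∑ i, μ i) * N := hlen' ▸ hl₁
    generalize V.geomDim.factorial * R ^ V.geomDim = G at hDb hμb
    have h2 : w₀.length + (D - 1) * w₀.length = D * w₀.length := by
      obtain ⟨D, rfl⟩ : ∃ D', D = D' + 1 := ⟨D - 1, by omega⟩
      rw [Nat.add_sub_cancel]; ring
    calc u₁.length + (D - 1) * w₀.length
        ≤ D * w₀.length + (∑ i, μ i) * N := by omega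
      _ ≤ G * (N * (N + 1)) + (V.geomDim * G) * N :=
        Nat.add_le_add (Nat.mul_le_mul hDb hl₀') (Nat.mul_le_mul_right _ hμb)
      _ ≤ _ := by nlinarith [Nat.zero_le (V.geomDim * G * N * N)]

end VASS

/-! ### Estimates for the recursive length bound -/

/-- Bound on the number of nodes visited by a walk that never leaves the small counters. -/
def nodeBound (n M d L k : ℕ) : ℕ := n * ((d + 1) * ((M + 1) * L)) ^ k

/-- Bound on the length of witnesses on counters of rank less than `k`. -/
def lengthBound (n M d g : ℕ) : ℕ → ℕ
  -- No rank is less than 0; the value 1 makes the threshold for small counters positive on the next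
  -- level.
  | 0 => 1
  | k + 1 => ((d + 2) * (M + 1) * (nodeBound n M d (lengthBound n M d g k) k + 1) ^ 2) ^ (g + 1)

theorem one_le_lengthBound (n M d g k : ℕ) : 1 ≤ lengthBound n M d g k := by
  cases k with
  | zero => exact le_rfl
  | succ k => exact Nat.one_le_pow _ _ (by positivity)

/-- Covers a simple walk to a deficient node, followed by a witness of smaller rank. -/
theorem nodeBound_add_le_lengthBound_succ {n M d g k : ℕ} (hn : 1 ≤ n) (hk : 1 ≤ k) :
    nodeBound n M d (lengthBound n M d g k) k + lengthBound n M d g k ≤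
      lengthBound n M d g (k + 1) := by
  rw [lengthBound]
  have h1 := one_le_lengthBound n M d g k
  set L := lengthBound n M d g k
  have h2 : L ≤ nodeBound n M d L k := by
    have h3 : L ≤ (d + 1) * ((M + 1) * L) := by nlinarith [Nat.zero_le (d * (M + 1) * L)]
    calc L ≤ (d + 1) * ((M + 1) * L) := h3
      _ ≤ ((d + 1) * ((M + 1) * L)) ^ k := Nat.le_self_pow (by omega) _
      _ ≤ _ := Nat.le_mul_of_pos_left _ hn
  set N := nodeBound n M d L k
  calc N + L ≤ (N + 1) ^ 2 := by nlinarith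
    _ ≤ (d + 2) * (M + 1) * (N + 1) ^ 2 := Nat.le_mul_of_pos_left _ (by positivity)
    _ ≤ _ := Nat.le_self_pow (by omega) _

/-- Covers a simple prefix followed by a loop from `exists_short_loop`; `g ≤ d` serves to absorb the
factorial. -/
theorem nodeBound_add_loop_le_lengthBound_succ {n M d g k : ℕ} (hg : g ≤ d) {N : ℕ}
    (hN : N = nodeBound n M d (lengthBound n M d g k) k) :
    N + g.factorial * (N * (N + 1) * (M + 1)) ^ g * (N * (N + 1) * (g + 1)) ≤
      lengthBound n M d g (k + 1) := by
  rw [lengthBound, ← hN]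
  have h1 : g.factorial ≤ (d + 1) ^ g :=
    (Nat.factorial_le_pow g).trans (Nat.pow_le_pow_left (by omega) _)
  set Z := (d + 1) * (M + 1) * (N * (N + 1)) with hZ
  have h2 : g.factorial * (N * (N + 1) * (M + 1)) ^ g ≤ Z ^ g := by
    calc _ ≤ (d + 1) ^ g * (N * (N + 1) * (M + 1)) ^ g := Nat.mul_le_mul_right _ h1
      _ = Z ^ g := by rw [← mul_pow, hZ]; congr 1; ring
  have h3 : N * (N + 1) * (g + 1) ≤ Z := by
    calc N * (N + 1) * (g + 1) ≤ N * (N + 1) * ((d + 1) * (M + 1)) :=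
          Nat.mul_le_mul_left _ (by nlinarith [Nat.zero_le (d * M)])
      _ = Z := by rw [hZ]; ring
  have h4 : Z + N ≤ (d + 2) * (M + 1) * (N + 1) ^ 2 := by
    calc Z + N ≤ (d + 1) * (M + 1) * (N + 1) ^ 2 + (M + 1) * (N + 1) ^ 2 := by
          apply Nat.add_le_add
          · rw [hZ]; exact Nat.mul_le_mul_left _ (by nlinarith)
          · nlinarith [Nat.zero_le (M * (N + 1) ^ 2)]
      _ = _ := by ring
  calc _ ≤ N + Z ^ g * Z := Nat.add_le_add_left (Nat.mul_le_mul h2 h3) _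
    _ ≤ N ^ (g + 1) + Z ^ (g + 1) := by
      rw [pow_succ Z]; exact Nat.add_le_add_right (Nat.le_self_pow (by omega) _) _
    _ ≤ (N + Z) ^ (g + 1) := pow_add_pow_le (Nat.zero_le _) (Nat.zero_le _) (by omega)
    _ ≤ _ := Nat.pow_le_pow_left (by omega) _

/-- The exponents in the estimate of `lengthBound`. -/
def lengthExponent (g : ℕ) : ℕ → ℕ
  | 0 => 0
  | k + 1 => (g + 1) * (3 + 2 * k + 2 * k * lengthExponent g k)

/-- With e the exponent at `k`, the node bound plus one costs 1 + (1 + e)k. Squaring it and adding 1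
for the factor `(d + 2) * (M + 1)` yields 3 + 2k + 2ke. -/
theorem lengthBound_le_pow (n M d g k : ℕ) :
    lengthBound n M d g k ≤ ((d + 2) * (n + 2) * (M + 2)) ^ lengthExponent g k := by
  set X := (d + 2) * (n + 2) * (M + 2) with hX
  have hX' : X = (d + 2) * (M + 2) * (n + 2) := by rw [hX]; ring
  induction k with
  | zero => simp [lengthBound, lengthExponent]
  | succ k ih =>
    have h1 := one_le_lengthBound n M d g k
    rw [lengthBound, lengthExponent]
    set L := lengthBound n M d g k
    set e := lengthExponent g k
    have hb : (d + 1) * ((M + 1) * L) ≤ X * X ^ e := by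
      rw [← mul_assoc]
      refine Nat.mul_le_mul ?_ ih
      rw [hX']
      calc (d + 1) * (M + 1) ≤ (d + 2) * (M + 2) := Nat.mul_le_mul (by omega) (by omega)
        _ ≤ _ := Nat.le_mul_of_pos_right _ (by omega)
    have hN : nodeBound n M d L k + 1 ≤ X ^ (1 + (1 + e) * k) := by
      rw [nodeBound, pow_add, pow_one, pow_mul, add_comm 1 e, pow_succ']
      have hp : 1 ≤ ((d + 1) * ((M + 1) * L)) ^ k := Nat.one_le_pow _ _ (by positivity)
      calc n * ((d + 1) * ((M + 1) * L)) ^ k + 1 ≤ (n + 1) * ((d + 1) * ((M + 1) * L)) ^ k := by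
            rw [add_one_mul n]; omega
        _ ≤ X * (X * X ^ e) ^ k := Nat.mul_le_mul ?_ (Nat.pow_le_pow_left hb _)
      rw [hX']
      exact le_trans (by omega) (Nat.le_mul_of_pos_left _ (by positivity))
    have hdM : (d + 2) * (M + 1) ≤ X := by
      rw [hX']
      exact (Nat.mul_le_mul_left _ (by omega)).trans (Nat.le_mul_of_pos_right _ (by omega))
    calc _ ≤ (X * (X ^ (1 + (1 + e) * k)) ^ 2) ^ (g + 1) :=
          Nat.pow_le_pow_left (Nat.mul_le_mul hdM (Nat.pow_le_pow_left hN _)) _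
      _ = _ := by
        rw [← pow_mul, ← pow_succ', ← pow_mul]
        congr 1
        ring

/-- The exponent starts at 3(g + 1), and each level multiplies it by at most 7g(g + 1) ≤ (4g + 2)².
-/
theorem lengthExponent_succ_le (g k : ℕ) (hk : k ≤ g) :
    lengthExponent g (k + 1) ≤ 3 * (g + 1) * (4 * g + 2) ^ (2 * k) := by
  induction k with
  | zero => simp [lengthExponent, mul_comm]
  | succ k ih =>
    have h1 := ih (by omega)
    rw [lengthExponent]
    have hpos : 1 ≤ lengthExponent g (k + 1) := by
      rw [lengthExponent]; exact Nat.mul_pos (by omega) (by omega)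
    set e := lengthExponent g (k + 1)
    calc (g + 1) * (3 + 2 * (k + 1) + 2 * (k + 1) * e) ≤ (g + 1) * (7 * (k + 1) * e) :=
          Nat.mul_le_mul_left _ (by nlinarith [Nat.zero_le k])
      _ ≤ (g + 1) * (7 * g * e) :=
          Nat.mul_le_mul_left _ (Nat.mul_le_mul_right _ (by omega))
      _ = e * (7 * g * (g + 1)) := by ring
      _ ≤ (3 * (g + 1) * (4 * g + 2) ^ (2 * k)) * (4 * g + 2) ^ 2 :=
          Nat.mul_le_mul h1 (by nlinarith)
      _ = _ := by rw [mul_assoc, ← pow_add]; congr 2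

theorem lengthBound_le (n M d g : ℕ) :
    lengthBound n M d g (g + 1) ≤
      (((d + 2) * (n + 2) * (M + 2)) ^ 2) ^ ((4 * g + 2) ^ (2 * g + 1)) := by
  refine (lengthBound_le_pow n M d g (g + 1)).trans ?_
  rw [← pow_mul]
  refine Nat.pow_le_pow_right (by positivity) ((lengthExponent_succ_le g g le_rfl).trans ?_)
  rw [pow_succ (4 * g + 2) (2 * g)]
  -- The factor 2 left over here is the square in the base.
  calc 3 * (g + 1) * (4 * g + 2) ^ (2 * g) ≤ 2 * (4 * g + 2) * (4 * g + 2) ^ (2 * g) :=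
        Nat.mul_le_mul_right _ (by omega)
    _ = _ := by ring

/-! ### The induction on the rank -/

namespace VASS

variable {Q : Type*} {d : ℕ} {V : VASS Q d}

/-- A walk from `a` to a node with a witness gives a witness at `a`. -/
theorem HasWitness.prepend {J : Finset (Fin d)} {a x : Q × (J → ℕ)}
    {w : List (Transition Q d × (Q × (J → ℕ)))} {L N : ℕ} (hx : V.HasWitness J x L)
    (hw : IsWalk (V.PartialStep J) a w x) (hN : w.length ≤ N) : V.HasWitness J a (N + L) := by
  obtain ⟨w₁, w₂, c, c', h1, h2, h3, h4, h5, h6⟩ := hx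
  refine ⟨w ++ w₁, w₂, c, c', hw.append h1, h2, h3, h4, h5, ?_⟩
  rw [List.length_append]
  omega

/-- Every node visited by a witness is reached by a walk from the initial node and has itself a
witness. -/
theorem exists_witness_of_mem {J : Finset (Fin d)} {a c c' x : Q × (J → ℕ)}
    {w₁ w₂ : List (Transition Q d × (Q × (J → ℕ)))} (h1 : IsWalk (V.PartialStep J) a w₁ c)
    (h2 : IsWalk (V.PartialStep J) c w₂ c') (hcc : c.1 = c'.1) (h0 : 0 ≤ walkEff w₂)
    (hne : walkEff w₂ ≠ 0) (hx : x ∈ walkNodes a (w₁ ++ w₂)) :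
    ∃ w, IsWalk (V.PartialStep J) a w x ∧ ∃ L, V.HasWitness J x L := by
  rcases h1.mem_walkNodes_append.1 hx with hx | hx
  · obtain ⟨u, v, rfl, hu, hv⟩ := h1.exists_split hx
    exact ⟨u, hu, _, v, w₂, c, c', hv, h2, hcc, h0, hne, le_rfl⟩
  · obtain ⟨u, v, rfl, hu, hv⟩ := h2.exists_split hx
    -- For a node inside the loop, the loop is rotated: `u` is repeated after `v`, from the larger
    -- counters of `c'`.
    obtain ⟨u', b, hu', hb, he, -⟩ := isWalk_partialStep_shift (a' := c') hu hcc.symm (fun j => by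
      have h3 := isWalk_partialStep_counters h2 j
      have h4 : 0 ≤ walkEff (u ++ v) j := h0 j
      show c.2 j ≤ c'.2 j
      omega)
    have heq : walkEff (v ++ u') = walkEff (u ++ v) := by
      simp only [walkEff, walkWeight_append] at he ⊢
      rw [he, add_comm]
    exact ⟨w₁ ++ u, h1.append hu, _, [], v ++ u', x, b, rfl, hv.append hu', hb.symm,
      heq ▸ h0, heq ▸ hne, le_rfl⟩

theorem hasWitness_lengthBound [Fintype Q] (k : ℕ) (J : Finset (Fin d)) (a : Q × (J → ℕ))
    (hk : V.coordRank J < k) (h : ∃ L, V.HasWitness J a L) :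
    V.HasWitness J a (lengthBound (Fintype.card Q) V.maxNorm d V.geomDim k) := by
  classical
  induction k generalizing J with
  | zero => exact absurd hk (Nat.not_lt_zero _)
  | succ k ih =>
  obtain ⟨-, w₁, w₂, c, c', h1, h2, hcc, h0, hne, -⟩ := h
  have hn : 1 ≤ Fintype.card Q := Fintype.card_pos_iff.2 ⟨a.1⟩
  have hL := one_le_lengthBound (Fintype.card Q) V.maxNorm d V.geomDim k
  have hsucc := nodeBound_add_le_lengthBound_succ (M := V.maxNorm) (d := d) (g := V.geomDim)
    (k := k) hn
  have hloop := nodeBound_add_loop_le_lengthBound_succ (n := Fintype.card Q) (M := V.maxNorm)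
    (k := k) V.geomDim_le rfl
  set L := lengthBound (Fintype.card Q) V.maxNorm d V.geomDim k
  set N := nodeBound (Fintype.card Q) V.maxNorm d L k with hN
  set B := (V.maxNorm + 1) * L
  have hB : 1 ≤ B := Nat.mul_pos (by omega) hL
  have hcount : ∀ {a b : Q × (J → ℕ)} {w : List (Transition Q d × (Q × (J → ℕ)))},
      IsWalk (V.PartialStep J) a w b → ∀ F : Finset (Q × (J → ℕ)),
      (∀ x ∈ F, x ∈ walkNodes a w ∧ V.coordRank J ≤ V.coordRank (smallCounters B x)) →
      F.card ≤ N := by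
    intro a b w hw F hF
    refine (card_nodes_le hw B F (fun x hx => (hF x hx).1) fun x hx => (hF x hx).2).trans ?_
    refine Nat.mul_le_mul_left _ ?_
    calc (d * B) ^ V.coordRank J ≤ ((d + 1) * B) ^ V.coordRank J :=
          Nat.pow_le_pow_left (Nat.mul_le_mul_right _ (by omega)) _
      _ ≤ ((d + 1) * B) ^ k := Nat.pow_le_pow_right (Nat.mul_pos (by omega) hB) (by omega)
  by_cases hdef : ∃ x ∈ walkNodes a (w₁ ++ w₂),
      V.coordRank (smallCounters B x) < V.coordRank J
  · obtain ⟨x₀, hx₀, hdx₀⟩ := hdef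
    obtain ⟨w, hw, hL₀⟩ := exists_witness_of_mem h1 h2 hcc h0 hne hx₀
    -- Cutting at the first deficient node ensures that all nodes before it are counted by `hcount`.
    obtain ⟨u, v, x, rfl, hu, hv, hdx, hall⟩ := hw.exists_split_first
      (fun x => V.coordRank (smallCounters B x) < V.coordRank J) ⟨x₀, hw.end_mem, hdx₀⟩
    obtain ⟨L₀, hL₀⟩ := hL₀
    have hxw := hL₀.prepend hv le_rfl
    have hlow := ih (smallCounters B x) (restrictNode (smallCounters_subset B x) x)
      (by omega) (hxw.restrict _)
    have hxL : V.HasWitness J x L := hlow.lift _ fun j hj => by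
      have h3 : B ≤ x.2 j := not_lt.1 fun h4 => hj (mem_smallCounters.2 ⟨j.2, h4⟩)
      exact (Nat.mul_le_mul_right _ (by omega)).trans h3
    obtain ⟨u', hu', -, hlu⟩ := hu.exists_simple_length_lt (walkNodes a u).toFinset (by simp)
    have hcard : ((walkNodes a u).toFinset.erase x).card ≤ N := hcount hu _ fun y hy => by
      rw [Finset.mem_erase, List.mem_toFinset] at hy
      exact ⟨hy.2, not_lt.1 ((hall y hy.2).resolve_left hy.1)⟩
    have hle : u'.length ≤ N := by
      -- The uncounted node `x` adds one, which the strict inequality `hlu` makes up for.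
      have := Finset.pred_card_le_card_erase (s := (walkNodes a u).toFinset) (a := x)
      omega
    exact (hxL.prepend hu' hle).mono (hsucc (by omega))
  · push Not at hdef
    have hmem := fun x => h1.mem_walkNodes_append (x := x) (w := w₂)
    obtain ⟨u₁, hu₁, -, hl₁⟩ := h1.exists_simple_length_lt (walkNodes a w₁).toFinset (by simp)
    have hN₁ : (walkNodes a w₁).toFinset.card ≤ N := hcount h1 _ fun y hy => by
      rw [List.mem_toFinset] at hy
      exact ⟨hy, hdef y ((hmem y).2 (Or.inl hy))⟩
    have hN₂ : (walkNodes c w₂).toFinset.card ≤ N := hcount h2 _ fun y hy => by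
      rw [List.mem_toFinset] at hy
      exact ⟨hy, hdef y ((hmem y).2 (Or.inr hy))⟩
    obtain ⟨u₂, c'', hu₂, hs, hu0, hune, hl₂⟩ := exists_short_loop h2 hcc h0 hne
      (walkNodes c w₂).toFinset (by simp) hN₂
    exact ⟨u₁, u₂, c, c'', hu₁, hu₂, hs, hu0, hune, by omega⟩

/-! ### Back to configurations and runs, and the theorem -/

/-- A configuration as a node in which all counters are recorded. -/
def toNode (c : Config Q d) : Q × (↥(Finset.univ : Finset (Fin d)) → ℕ) :=
  (c.state, fun j => c.counters j)

/-- A node in which all counters are recorded as a configuration. -/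
def ofNode (c : Q × (↥(Finset.univ : Finset (Fin d)) → ℕ)) : Config Q d :=
  ⟨c.1, fun j => c.2 ⟨j, Finset.mem_univ j⟩⟩

theorem IsRun.exists_isWalk {s c : Config Q d} {π : List (Transition Q d)} (h : V.IsRun s π c) :
    ∃ w, IsWalk (V.PartialStep Finset.univ) (toNode s) w (toNode c) ∧ w.map Prod.fst = π := by
  induction h with
  | nil c => exact ⟨[], rfl, rfl⟩
  | @cons c c' c'' t π hstep _ ih =>
    obtain ⟨w, hw, rfl⟩ := ih
    exact ⟨(t, toNode c') :: w,
      ⟨⟨hstep.1, hstep.2.1, hstep.2.2.1, fun j => hstep.2.2.2 j⟩, hw⟩, rfl⟩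

theorem isRun_of_isWalk {a b : Q × (↥(Finset.univ : Finset (Fin d)) → ℕ)}
    {w : List (Transition Q d × (Q × (↥(Finset.univ : Finset (Fin d)) → ℕ)))}
    (hw : IsWalk (V.PartialStep Finset.univ) a w b) :
    V.IsRun (ofNode a) (w.map Prod.fst) (ofNode b) := by
  induction w generalizing a with
  | nil => cases hw; exact IsRun.nil _
  | cons e w ih =>
    exact IsRun.cons (c' := ofNode e.2)
      ⟨hw.1.1, hw.1.2.1, hw.1.2.2.1, fun j => hw.1.2.2.2 ⟨j, Finset.mem_univ j⟩⟩ (ih hw.2)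

theorem IsUnboundednessWitness.hasWitness {s : Config Q d} {π : List (Transition Q d)}
    (h : V.IsUnboundednessWitness s π) : ∃ L, V.HasWitness Finset.univ (toNode s) L := by
  obtain ⟨π₁, π₂, c, c', -, -, h1, h2, ⟨hs, hle⟩, hne⟩ := h
  obtain ⟨w₁, hw₁, -⟩ := h1.exists_isWalk
  obtain ⟨w₂, hw₂, -⟩ := h2.exists_isWalk
  have hc : ∀ j : Fin d, (c.counters j : ℤ) + walkEff w₂ j = c'.counters j := fun j =>
    isWalk_partialStep_counters hw₂ ⟨j, Finset.mem_univ j⟩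
  refine ⟨_, w₁, w₂, _, _, hw₁, hw₂, hs, ?_, ?_, le_rfl⟩
  · intro j
    have h3 := hc j
    have h4 : c.counters j ≤ c'.counters j := hle j
    show 0 ≤ walkEff w₂ j
    omega
  · intro h0
    refine hne (funext fun j => ?_)
    have h3 := hc j
    rw [h0, Pi.zero_apply] at h3
    omega

theorem HasWitness.exists_isUnboundednessWitness {s : Config Q d} {L : ℕ}
    (h : V.HasWitness Finset.univ (toNode s) L) :
    ∃ π, V.IsUnboundednessWitness s π ∧ π.length ≤ L := by
  obtain ⟨w₁, w₂, c, c', h1, h2, hs, h0, hne, hL⟩ := h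
  have hc : ∀ j : Fin d, ((ofNode c).counters j : ℤ) + walkEff w₂ j = (ofNode c').counters j :=
    fun j => isWalk_partialStep_counters h2 ⟨j, Finset.mem_univ j⟩
  refine ⟨w₁.map Prod.fst ++ w₂.map Prod.fst, ⟨_, _, ofNode c, ofNode c', rfl, ?_,
    isRun_of_isWalk h1, isRun_of_isWalk h2, ⟨hs, ?_⟩, ?_⟩, by simpa using hL⟩
  · intro h
    rw [List.map_eq_nil_iff] at h
    exact hne (by rw [h]; rfl)
  · intro j
    have h3 := hc j
    have h4 : 0 ≤ walkEff w₂ j := h0 j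
    show (ofNode c).counters j ≤ (ofNode c').counters j
    omega
  · intro h
    refine hne (funext fun j => ?_)
    have h3 := hc j
    rw [h] at h3
    show walkEff w₂ j = 0
    omega

end VASS

theorem theorem5p1 :
    ∃ P : MvPolynomial (Fin 3) ℕ,
      ∀ (Q : Type*) [Fintype Q] (d : ℕ) (V : VASS Q d) (s : Config Q d),
        (∃ π, V.IsUnboundednessWitness s π) →
          ∃ π, V.IsUnboundednessWitness s π ∧
            π.length ≤ (MvPolynomial.eval ![d, Fintype.card Q, V.maxNorm] P) ^
              ((4 * V.geomDim + 2) ^ (2 * V.geomDim + 1)) := by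
  refine ⟨((MvPolynomial.X 0 + 2) * (MvPolynomial.X 1 + 2) * (MvPolynomial.X 2 + 2)) ^ 2, ?_⟩
  rintro Q _ d V s ⟨π₀, hπ₀⟩
  obtain ⟨π, hπ, hlen⟩ := (VASS.hasWitness_lengthBound (V.geomDim + 1) Finset.univ _
    (Nat.lt_succ_of_le (V.coordRank_le_geomDim _)) hπ₀.hasWitness).exists_isUnboundednessWitness
  refine ⟨π, hπ, hlen.trans ((lengthBound_le _ _ _ _).trans (le_of_eq ?_))⟩
  simp [map_ofNat]
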